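/- Let $l\ge 0$ be an integer, $n=2l$, and $k^\ast=n-k+1$ for $1\le k\le n$. Let $J$ be the $l\times l$ matrix with ones on the anti-diagonal and zeros elsewhere, and let $F=\begin{pmatrix}0&J\\-J&0\end{pmatrix}$. Let $\mathrm{Sp}_{n}(\mathbb C)=\{A\in \mathrm{GL}_{n}(\mathbb C): A^{T}FA=F\}$, with Lie algebra $\mathfrak{sp}_{n}=\{x\in\mathfrak{gl}_{n}(\mathbb C): x^{T}F+Fx=0\}$, let $B$ be the standard Borel subgroup of upper-triangular matrices in $\mathrm{Sp}_{n}(\mathbb C)$, and let $\mathcal N(2)=\{x\in\mathfrak{sp}_{n}: x^2=0\}$, on which $B$ acts by conjugation. A symplectic oriented link pattern of size $l$ is a set of arrows on the vertices $1,\dots,l$, each an oriented arrow either without a dot or with a dot (a loop having one of two orientations, counterclockwise or clockwise), such that every vertex is touched by at most one arrow and there are no loops without dots. To such a pattern $p$ one attaches the matrix $x_p$ which is the sum of the following contributions of its arrows, where $E_{a,b}$ are the elementary $n\times n$ matrices and $i<j$ are vertices: - an arrow $j\to i$ without dot contributes $E_{i,j}-E_{j^\ast,i^\ast}$, and an arrow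 $i\to j$ without dot contributes $E_{j,i}-E_{i^\ast,j^\ast}$; - an arrow $j\to i$ with dot contributes $E_{i,j^\ast}+E_{j,i^\ast}$, and an arrow $i\to j$ with dot contributes $E_{j^\ast,i}+E_{i^\ast,j}$; - a counterclockwise loop with dot at $i$ contributes $E_{i,i^\ast}$, and a clockwise loop with dot at $i$ contributes $E_{i^\ast,i}$. Then $x_p\in\mathcal N(2)$ for every symplectic oriented link pattern $p$ of size $l$, and $p\mapsto B\cdot x_p$ is a bijection from the set of symplectic oriented link patterns of size $l$ onto the set of $B$-orbits in $\mathcal N(2)$. In particular, there are only finitely many $B$-orbits in $\mathcal N(2)$. -/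

import Mathlib

namespace SympLink

open Matrix

/-- The involution `k ↦ k* = n - k + 1` on `{1, …, n}`, here `n = 2 * l` and indices start at `0`. -/
abbrev dual {l : ℕ} (k : Fin (2 * l)) : Fin (2 * l) := k.rev

/-- The matrix `F = [[0, J], [-J, 0]]` of the symplectic form on `ℂ^{2l}`, where `J` is the
`l × l` matrix with ones on the anti-diagonal and zeros elsewhere. -/
def form (l : ℕ) : Matrix (Fin (2 * l)) (Fin (2 * l)) ℂ :=
  Matrix.of fun i j => if j = dual i then (if i.val < l then 1 else -1) else 0

/-- The symplectic group `Sp_{2l}(ℂ)`: the invertible `A` with `Aᵀ F A = F`. -/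
def Sp (l : ℕ) : Subgroup (GL (Fin (2 * l)) ℂ) where
  carrier := {A | A.valᵀ * form l * A.val = form l}
  one_mem' := by simp
  mul_mem' := by
    intro a b ha hb
    simp only [Set.mem_ofPred_eq] at ha hb ⊢
    rw [Units.val_mul, transpose_mul]
    calc b.valᵀ * a.valᵀ * form l * (a.val * b.val)
        = b.valᵀ * (a.valᵀ * form l * a.val) * b.val := by simp only [mul_assoc]
      _ = form l := by rw [ha, hb]
  inv_mem' := by
    intro a ha
    simp only [Set.mem_ofPred_eq] at ha ⊢
    have h1 : a.val * (a⁻¹).val = 1 := a.mul_inv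
    have h2 : (a⁻¹).valᵀ * a.valᵀ = 1 := by rw [← transpose_mul, h1, transpose_one]
    calc (a⁻¹).valᵀ * form l * (a⁻¹).val
        = (a⁻¹).valᵀ * (a.valᵀ * form l * a.val) * (a⁻¹).val := by rw [ha]
      _ = ((a⁻¹).valᵀ * a.valᵀ) * form l * (a.val * (a⁻¹).val) := by simp only [mul_assoc]
      _ = form l := by rw [h1, h2, one_mul, mul_one]

/-- The subgroup of upper-triangular matrices of `GL_{2l}(ℂ)`. -/
def upperTriangular (l : ℕ) : Subgroup (GL (Fin (2 * l)) ℂ) where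
  carrier := {A | ∀ i j, j < i → A.val i j = 0}
  one_mem' := by
    intro i j h
    simp [h.ne']
  mul_mem' := by
    intro a b ha hb
    have ha' : a.val.BlockTriangular id := fun i j h => ha i j h
    have hb' : b.val.BlockTriangular id := fun i j h => hb i j h
    exact fun i j h => (ha'.mul hb') h
  inv_mem' := by
    intro a ha
    have ha' : a.val.BlockTriangular id := fun i j h => ha i j h
    have : Invertible a.val := a.invertible
    have h := blockTriangular_inv_of_blockTriangular ha'
    intro i j hij
    rw [Matrix.coe_units_inv]
    exact h hij

/-- The standard Borel subgroup `B` of `Sp_{2l}(ℂ)`: its upper-triangular matrices. -/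
def borel (l : ℕ) : Subgroup (GL (Fin (2 * l)) ℂ) := Sp l ⊓ upperTriangular l

/-- The Lie algebra `sp_{2l}(ℂ)`, as a subspace of the `2l × 2l` matrices: the matrices `x` with `xᵀ F + F x = 0` (see `mem_sp`). -/
def sp (l : ℕ) : Submodule ℂ (Matrix (Fin (2 * l)) (Fin (2 * l)) ℂ) :=
  skewAdjointMatricesSubmodule (form l)

theorem mem_sp {l : ℕ} (x : Matrix (Fin (2 * l)) (Fin (2 * l)) ℂ) :
    x ∈ sp l ↔ xᵀ * form l + form l * x = 0 := by
  rw [sp, mem_skewAdjointMatricesSubmodule,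
    Matrix.IsSkewAdjoint, Matrix.IsAdjointPair, mul_neg, eq_neg_iff_add_eq_zero]

/-- The variety `N(2)` of elements of `sp_{2l}(ℂ)` with square zero. -/
def N2 (l : ℕ) : Set (Matrix (Fin (2 * l)) (Fin (2 * l)) ℂ) := {x | x ∈ sp l ∧ x ^ 2 = 0}

theorem conj_mem_N2 {l : ℕ} {b : GL (Fin (2 * l)) ℂ} (hb : b ∈ borel l)
    {x : Matrix (Fin (2 * l)) (Fin (2 * l)) ℂ} (hx : x ∈ N2 l) :
    b.val * x * (b⁻¹).val ∈ N2 l := by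
  obtain ⟨hx1, hx2⟩ := hx
  have hS : b.valᵀ * form l * b.val = form l := hb.1
  have h1 : b.val * (b⁻¹).val = 1 := b.mul_inv
  have h1' : (b⁻¹).val * b.val = 1 := b.inv_mul
  have h2 : (b⁻¹).valᵀ * b.valᵀ = 1 := by rw [← transpose_mul, h1, transpose_one]
  have h3 : b.valᵀ * form l = form l * (b⁻¹).val := by
    calc b.valᵀ * form l = b.valᵀ * form l * (b.val * (b⁻¹).val) := by rw [h1, mul_one]
      _ = (b.valᵀ * form l * b.val) * (b⁻¹).val := by simp only [mul_assoc]
      _ = _ := by rw [hS]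
  have h4 : form l * b.val = (b⁻¹).valᵀ * form l := by
    calc form l * b.val = ((b⁻¹).valᵀ * b.valᵀ) * (form l * b.val) := by rw [h2, one_mul]
      _ = (b⁻¹).valᵀ * (b.valᵀ * form l * b.val) := by simp only [mul_assoc]
      _ = _ := by rw [hS]
  rw [mem_sp] at hx1
  refine ⟨?_, ?_⟩
  · rw [mem_sp, transpose_mul, transpose_mul]
    calc (b⁻¹).valᵀ * (xᵀ * b.valᵀ) * form l + form l * (b.val * x * (b⁻¹).val)
        = (b⁻¹).valᵀ * xᵀ * (b.valᵀ * form l) + (form l * b.val) * x * (b⁻¹).val := by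
          simp only [mul_assoc]
      _ = (b⁻¹).valᵀ * (xᵀ * form l + form l * x) * (b⁻¹).val := by
          rw [h3, h4]; simp only [mul_assoc, mul_add, add_mul]
      _ = 0 := by rw [hx1, mul_zero, zero_mul]
  · calc (b.val * x * (b⁻¹).val) ^ 2
        = b.val * x * ((b⁻¹).val * b.val) * x * (b⁻¹).val := by
          rw [pow_two]; simp only [mul_assoc]
      _ = b.val * x ^ 2 * (b⁻¹).val := by rw [h1', mul_one, pow_two]; simp only [mul_assoc]
      _ = 0 := by rw [hx2, mul_zero, zero_mul]

/-- The action of `B` on `N(2)` by conjugation, `b • x = b x b⁻¹`. -/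
instance conjAction (l : ℕ) : MulAction (borel l) (N2 l) where
  smul b x := ⟨b.1.val * x.1 * (b.1⁻¹).val, conj_mem_N2 b.2 x.2⟩
  one_smul x := by
    apply Subtype.ext
    change (1 : GL (Fin (2 * l)) ℂ).val * x.1 * ((1 : GL (Fin (2 * l)) ℂ)⁻¹).val = x.1
    simp
  mul_smul a b x := by
    apply Subtype.ext
    change (a.1 * b.1).val * x.1 * ((a.1 * b.1)⁻¹).val
      = a.1.val * (b.1.val * x.1 * (b.1⁻¹).val) * (a.1⁻¹).val
    rw [_root_.mul_inv_rev, Units.val_mul, Units.val_mul]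
    simp only [mul_assoc]

/-- The set of orbits of `B` on `N(2)`. -/
abbrev Orbits (l : ℕ) : Type := MulAction.orbitRel.Quotient (borel l) (N2 l)

/-- The arrows that can occur in a drawing on the vertices `1, …, l`. A loop has one of two
orientations, counterclockwise or clockwise. Loops without dots are never allowed in the patterns
below, so for them no orientation is recorded. -/
inductive Arrow (l : ℕ) : Type
  /-- An arrow without dot from the vertex `s` to the vertex `t`. -/
  | plain (s t : Fin l) : Arrow l
  /-- An arrow with dot from the vertex `s` to a different vertex `t`. -/
  | dotted (s t : Fin l) (h : s ≠ t) : Arrow l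
  /-- A counterclockwise loop with dot at the vertex `i`. -/
  | dottedLoopCcw (i : Fin l) : Arrow l
  /-- A clockwise loop with dot at the vertex `i`. -/
  | dottedLoopCw (i : Fin l) : Arrow l

/-- The vertex `v` is the source or the target of the arrow. -/
def Arrow.Touches {l : ℕ} (v : Fin l) : Arrow l → Prop
  | .plain s t => v = s ∨ v = t
  | .dotted s t _ => v = s ∨ v = t
  | .dottedLoopCcw i => v = i
  | .dottedLoopCw i => v = i

/-- Symplectic oriented link patterns of size `l`. -/
@[ext]
structure Solp (l : ℕ) : Type where
  arrows : Finset (Arrow l)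
  /-- Every vertex is touched by at most one arrow. -/
  touched_once : ∀ v : Fin l, ∀ a ∈ arrows, ∀ b ∈ arrows, a.Touches v → b.Touches v → a = b
  /-- There are no loops of arrows without dots. -/
  no_plain_loop : ∀ i : Fin l, Arrow.plain i i ∉ arrows

/-- The vertex `i ∈ {1, …, l}` as an index in `{1, …, 2l}`. -/
abbrev idx {l : ℕ} (i : Fin l) : Fin (2 * l) := Fin.castLE (by omega) i

/-- The elementary matrix `E_{a,b}`. -/
abbrev E {l : ℕ} (a b : Fin (2 * l)) : Matrix (Fin (2 * l)) (Fin (2 * l)) ℂ :=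
  Matrix.single a b 1

/-- The part of the representative matrix contributed by an arrow. -/
def Arrow.matrix {l : ℕ} : Arrow l → Matrix (Fin (2 * l)) (Fin (2 * l)) ℂ
  | .plain s t => E (idx t) (idx s) - E (dual (idx s)) (dual (idx t))
  | .dotted s t _ =>
      if t < s then E (idx t) (dual (idx s)) + E (idx s) (dual (idx t))
      else E (dual (idx t)) (idx s) + E (dual (idx s)) (idx t)
  | .dottedLoopCcw i => E (idx i) (dual (idx i))
  | .dottedLoopCw i => E (dual (idx i)) (idx i)

/-- The representative matrix of a symplectic oriented link pattern. -/
def Solp.matrix {l : ℕ} (p : Solp l) : Matrix (Fin (2 * l)) (Fin (2 * l)) ℂ :=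
  ∑ a ∈ p.arrows, a.matrix

end SympLink

/-! Since `F * F = -1` and `Fᵀ = -F`, every `x` in the Lie algebra is `S * F` with `S = -x * F`
symmetric. The condition `x ^ 2 = 0` becomes `S * F * S = 0`, and conjugation by a symplectic `b`
becomes the congruence `S ↦ b * S * bᵀ` (`mem_sp_iff`, `mul_form_mem_N2_iff`, `conj_mul_form`).

Every orbit meets a pattern by symmetric Gaussian elimination inside `B`. A unipotent element takes
a vector to the line of its last nonzero coordinate (`exists_borel_clear`). Applied to the last
nonzero row, and then to the row paired with it, this produces a pivot at some `(i, j)`, which the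
torus rescales at will (`exists_borel_isPivot`). Isotropy kills the rows `i*` and `j*`, so the rest
of `S` lives on a smaller index set stable under `*` (`IsPivot.exists_split`). The pivot is the
matrix of one arrow (`exists_arrow`), and `exists_solp` is the resulting induction.

Distinct patterns lie in distinct orbits because `x_p` has at most one nonzero entry in each row and
column. If `x_q * b = b * x_p`, a nonzero entry of `x_q` forces one of `x_p` in the same column,
weakly below (`Solp.exists_lower_entry`). Returning with `b⁻¹` shows that the two positions agree.
Hence the supports coincide, and the support determines the arrows. -/

namespace SympLink

open Matrix

variable {l : ℕ}

/-! ### The symplectic form, and `N(2)` as isotropic symmetric matrices -/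

/-- The sign `F k k*` of the form. -/
def sg (k : Fin (2 * l)) : ℂ := if k.val < l then 1 else -1

theorem form_apply (i j : Fin (2 * l)) : form l i j = if j = dual i then sg i else 0 := rfl

theorem dual_dual (k : Fin (2 * l)) : dual (dual k) = k := Fin.rev_rev k

theorem eq_dual_comm {i j : Fin (2 * l)} : i = dual j ↔ j = dual i := by
  constructor <;> rintro rfl <;> exact (dual_dual _).symm

theorem val_dual (k : Fin (2 * l)) : (dual k).val = 2 * l - (k.val + 1) := Fin.val_rev k

theorem dual_ne (k : Fin (2 * l)) : dual k ≠ k := by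
  intro h
  have := congrArg Fin.val h
  rw [val_dual] at this
  omega

theorem dual_lt_iff {i j : Fin (2 * l)} : dual i < j ↔ dual j < i := by
  rw [Fin.lt_def, Fin.lt_def, val_dual, val_dual]
  omega

theorem sg_dual (k : Fin (2 * l)) : sg (dual k) = -sg k := by
  have h := k.isLt
  unfold sg
  rw [val_dual]
  by_cases hk : k.val < l
  · rw [if_neg (by omega), if_pos hk]
  · rw [if_pos (by omega), if_neg hk, neg_neg]

theorem sg_mul_self (k : Fin (2 * l)) : sg k * sg k = 1 := by
  unfold sg
  split_ifs <;> norm_num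

theorem sg_ne_zero (k : Fin (2 * l)) : sg k ≠ 0 := by
  unfold sg
  split_ifs <;> norm_num

theorem form_mul_apply {m : Type*} (S : Matrix (Fin (2 * l)) m ℂ) (r : Fin (2 * l)) (c : m) :
    (form l * S) r c = sg r * S (dual r) c := by
  rw [mul_apply, Finset.sum_eq_single (dual r)]
  · simp [form_apply]
  · intro b _ hb
    simp [form_apply, hb]
  · simp

theorem mul_form_apply {m : Type*} (S : Matrix m (Fin (2 * l)) ℂ) (r : m) (c : Fin (2 * l)) :
    (S * form l) r c = S r (dual c) * sg (dual c) := by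
  rw [mul_apply, Finset.sum_eq_single (dual c)]
  · simp [form_apply]
  · intro b _ hb
    have : c ≠ dual b := fun h => hb (eq_dual_comm.1 h)
    simp [form_apply, this]
  · simp

theorem form_mulVec_apply (v : Fin (2 * l) → ℂ) (r : Fin (2 * l)) :
    (form l *ᵥ v) r = sg r * v (dual r) := by
  rw [mulVec, dotProduct, Finset.sum_eq_single (dual r)]
  · simp [form_apply]
  · intro b _ hb
    simp [form_apply, hb]
  · simp

theorem form_mul_form : form l * form l = -1 := by
  ext i j
  rw [form_mul_apply, form_apply, dual_dual, sg_dual, neg_apply, one_apply]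
  by_cases h : i = j
  · subst h; simp [sg_mul_self]
  · simp [h, Ne.symm h]

theorem form_transpose : (form l)ᵀ = -form l := by
  ext i j
  rw [transpose_apply, neg_apply, form_apply, form_apply]
  by_cases h : j = dual i
  · subst h
    simp [sg_dual]
  · have : i ≠ dual j := fun h' => h (eq_dual_comm.1 h')
    simp [h, this]

/-- The defining equation multiplied by the invertible `F`, using that `F` is antisymmetric. -/
theorem mem_sp_iff (x : Matrix (Fin (2 * l)) (Fin (2 * l)) ℂ) :
    x ∈ sp l ↔ (-(x * form l)).IsSymm := by
  rw [mem_sp, IsSymm, transpose_neg, transpose_mul, form_transpose, neg_mul, neg_neg]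
  constructor
  · intro h
    have h' : xᵀ * form l = -(form l * x) := eq_neg_of_add_eq_zero_left h
    calc form l * xᵀ = -(form l * (xᵀ * form l) * form l) := by
          rw [mul_assoc, mul_assoc, form_mul_form]; simp
      _ = form l * form l * x * form l := by rw [h']; simp [mul_assoc]
      _ = -(x * form l) := by rw [form_mul_form]; simp
  · intro h
    calc xᵀ * form l + form l * x = -(form l * (form l * xᵀ) * form l) + form l * x := by
          rw [← mul_assoc (form l), form_mul_form]; simp
      _ = 0 := by
          rw [h]
          simp only [mul_neg, neg_mul, neg_neg, mul_assoc, form_mul_form, mul_one]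
          simp

/-- A symmetric matrix `S` whose column space is isotropic; equivalently `S * F` is in `N2`. -/
structure IsotropicSymm (S : Matrix (Fin (2 * l)) (Fin (2 * l)) ℂ) : Prop where
  symm : S.IsSymm
  isotropic : S * form l * S = 0

/-- `(S * F) ^ 2 = (S * F * S) * F`, and `F` is invertible. -/
theorem mul_form_mem_N2_iff (S : Matrix (Fin (2 * l)) (Fin (2 * l)) ℂ) :
    S * form l ∈ N2 l ↔ IsotropicSymm S := by
  have h1 : -(S * form l * form l) = S := by rw [mul_assoc, form_mul_form]; simp
  constructor
  · rintro ⟨h, h2⟩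
    rw [mem_sp_iff, h1] at h
    refine ⟨h, ?_⟩
    calc S * form l * S = -((S * form l) ^ 2 * form l) := by
          rw [pow_two, mul_assoc (S * form l), mul_assoc S (form l) (form l), form_mul_form]; simp
      _ = 0 := by rw [h2]; simp
  · rintro ⟨h, h2⟩
    refine ⟨by rwa [mem_sp_iff, h1], ?_⟩
    rw [pow_two, ← mul_assoc, h2, zero_mul]

theorem exists_eq_mul_form {x : Matrix (Fin (2 * l)) (Fin (2 * l)) ℂ} (hx : x ∈ N2 l) :
    ∃ S, IsotropicSymm S ∧ x = S * form l := by
  have h : x = -(x * form l) * form l := by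
    rw [neg_mul, mul_assoc, form_mul_form]; simp
  exact ⟨-(x * form l), (mul_form_mem_N2_iff _).1 (h ▸ hx), h⟩

/-- For symplectic `b` one has `F * b⁻¹ = bᵀ * F`, so conjugation turns into congruence. -/
theorem conj_mul_form {b : GL (Fin (2 * l)) ℂ} (hb : b ∈ Sp l)
    (S : Matrix (Fin (2 * l)) (Fin (2 * l)) ℂ) :
    b.val * (S * form l) * (b⁻¹).val = b.val * S * b.valᵀ * form l := by
  have hS : b.valᵀ * form l * b.val = form l := hb
  have h1 : b.val * (b⁻¹).val = 1 := b.mul_inv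
  have h3 : form l * (b⁻¹).val = b.valᵀ * form l := by
    calc form l * (b⁻¹).val = b.valᵀ * form l * (b.val * (b⁻¹).val) := by
          rw [← mul_assoc, hS]
      _ = _ := by rw [h1, mul_one]
  rw [mul_assoc, mul_assoc, h3]
  simp only [mul_assoc]

theorem IsotropicSymm.congr {S : Matrix (Fin (2 * l)) (Fin (2 * l)) ℂ} (hS : IsotropicSymm S)
    {b : GL (Fin (2 * l)) ℂ} (hb : b ∈ borel l) : IsotropicSymm (b.val * S * b.valᵀ) := by
  rw [← mul_form_mem_N2_iff, ← conj_mul_form hb.1]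
  exact conj_mem_N2 hb ((mul_form_mem_N2_iff S).2 hS)

/-- The dual row of a pivot row vanishes. -/
theorem IsotropicSymm.dual_row_eq_zero {S : Matrix (Fin (2 * l)) (Fin (2 * l)) ℂ}
    (hS : IsotropicSymm S) {i j : Fin (2 * l)} (hij : S i j ≠ 0) (h : ∀ k, k ≠ j → S i k = 0)
    (m : Fin (2 * l)) : S (dual j) m = 0 := by
  have h0 := congrFun (congrFun hS.isotropic i) m
  -- Entry `(i, m)` of `S * F * S` collapses to `S i j * sg j * S (dual j) m`.
  rw [mul_assoc, mul_apply, Finset.sum_eq_single j] at h0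
  · rw [form_mul_apply, Matrix.zero_apply] at h0
    have := sg_ne_zero j
    simp_all
  · intro k _ hk
    rw [h k hk, zero_mul]
  · simp

/-! ### Unipotent elements of `B` clearing a vector -/

/-- Square-zero strictly upper triangular elements of the Lie algebra exponentiate into `B`. -/
theorem exists_borel_eq_one_sub {x : Matrix (Fin (2 * l)) (Fin (2 * l)) ℂ} (hx : x ∈ N2 l)
    (ht : ∀ i j, j ≤ i → x i j = 0) : ∃ b ∈ borel l, b.val = 1 - x := by
  obtain ⟨h1, h2⟩ := hx
  rw [mem_sp] at h1
  rw [pow_two] at h2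
  refine ⟨⟨1 - x, 1 + x, by noncomm_ring; simp [h2], by noncomm_ring; simp [h2]⟩, ⟨?_, ?_⟩, rfl⟩
  · change (1 - x)ᵀ * form l * (1 - x) = form l
    have h3 : xᵀ * form l = -(form l * x) := eq_neg_of_add_eq_zero_left h1
    rw [transpose_sub, transpose_one, sub_mul, one_mul, h3]
    calc _ = form l - form l * (x * x) := by noncomm_ring
      _ = form l := by rw [h2]; simp
  · intro i j hij
    change (1 - x) i j = 0
    rw [Matrix.sub_apply, ht i j hij.le, one_apply_ne hij.ne', sub_zero]

theorem dotProduct_form_mulVec_swap (u v : Fin (2 * l) → ℂ) :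
    u ⬝ᵥ (form l *ᵥ v) = -(v ⬝ᵥ (form l *ᵥ u)) := by
  rw [dotProduct_mulVec, ← mulVec_transpose, form_transpose, neg_mulVec, neg_dotProduct,
    dotProduct_comm]

theorem dotProduct_form_mulVec_self (u : Fin (2 * l) → ℂ) : u ⬝ᵥ (form l *ᵥ u) = 0 := by
  have := dotProduct_form_mulVec_swap u u
  exact self_eq_neg.1 this

/-- The isotropy product has four terms, each carrying a pairing among `u` and `f`; the
self-pairings vanish because the form is alternating. -/
theorem isotropicSymm_vecMulVec {u f : Fin (2 * l) → ℂ} (h : u ⬝ᵥ (form l *ᵥ f) = 0) (c : ℂ) :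
    IsotropicSymm (c • (vecMulVec u f + vecMulVec f u)) := by
  have h' : f ⬝ᵥ (form l *ᵥ u) = 0 := by rw [dotProduct_form_mulVec_swap, h, neg_zero]
  have key : ∀ a b c d : Fin (2 * l) → ℂ, b ⬝ᵥ (form l *ᵥ c) = 0 →
      vecMulVec a b * (form l * vecMulVec c d) = 0 := by
    intro a b c d h
    rw [mul_vecMulVec, vecMulVec_mul_vecMulVec, h]
    ext; simp [vecMulVec_apply]
  refine ⟨?_, ?_⟩
  · ext i j
    simp only [transpose_apply, Matrix.smul_apply, Matrix.add_apply, vecMulVec_apply, smul_eq_mul]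
    ring
  · rw [smul_mul_assoc, smul_mul_assoc, mul_smul_comm, mul_assoc, mul_add, add_mul, mul_add,
      mul_add]
    rw [key _ _ _ _ h', key _ _ _ _ h, key _ _ _ _ (dotProduct_form_mulVec_self u),
      key _ _ _ _ (dotProduct_form_mulVec_self f)]
    simp

theorem borel_apply_eq_zero {b : GL (Fin (2 * l)) ℂ} (hb : b ∈ borel l) {i j : Fin (2 * l)}
    (h : j < i) : b.val i j = 0 := hb.2 i j h

/-- A vector `v` of height `i` is moved to the line of the `i`-th basis vector by a unipotent
element of `B` which differs from the identity only in column `i` and row `dual i`. -/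
theorem exists_borel_clear (v : Fin (2 * l) → ℂ) (i : Fin (2 * l)) (hi : v i ≠ 0)
    (hv : ∀ k, i < k → v k = 0) :
    ∃ b ∈ borel l, (∀ k m, k ≠ dual i → m ≠ i → b.val k m = (1 : Matrix _ _ ℂ) k m) ∧
      (∀ k, k ≠ i → k ≠ dual i → b.val k i = -(v k / v i)) ∧ (∀ k, b.val k k = 1) ∧
      (∀ m, m ≠ i → v (dual m) = 0 → ∀ k, b.val k m = (1 : Matrix _ _ ℂ) k m) ∧
      b.val *ᵥ v = Pi.single i (v i) := by
  have hii := dual_ne i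
  let f : Fin (2 * l) → ℂ := Pi.single (dual i) 1
  -- The generator `N` built from `u` and `f` satisfies `N v = v i • (u + u (dual i) • f)`. The
  -- second term contributes once more at `dual i`, so `u` takes only half of that coordinate.
  let u : Fin (2 * l) → ℂ := fun k =>
    if k = i then 0 else if k = dual i then v k / v i / 2 else v k / v i
  have hui : u i = 0 := by simp [u]
  have hu0 : ∀ k, v k = 0 → u k = 0 := by
    intro k hk
    simp only [u, hk]
    simp
  have hf : ∀ w : Fin (2 * l) → ℂ, f ⬝ᵥ (form l *ᵥ w) = sg (dual i) * w i := by
    intro w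
    rw [single_one_dotProduct, form_mulVec_apply, dual_dual]
  have huf : u ⬝ᵥ (form l *ᵥ f) = 0 := by
    rw [dotProduct_form_mulVec_swap, hf, hui]
    simp
  -- This sign cancels the one in the pairing of `f` with a vector.
  let c := sg (dual i)
  have hcc : c * c = 1 := sg_mul_self _
  have hN := (mul_form_mem_N2_iff _).2 (isotropicSymm_vecMulVec huf c)
  have hNe : ∀ k m, (c • (vecMulVec u f + vecMulVec f u) * form l) k m =
      c * sg (dual m) * (u k * (if m = i then 1 else 0)
        + (if k = dual i then u (dual m) else 0)) := by
    intro k m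
    have h1 : f (dual m) = if m = i then 1 else 0 := by
      by_cases h : m = i
      · simp [f, h]
      · have : dual m ≠ dual i := fun h' => h (Fin.rev_injective h')
        simp [f, h, this]
    have h2 : f k = if k = dual i then 1 else 0 := by
      simp [f, Pi.single_apply]
    rw [mul_form_apply, Matrix.smul_apply, Matrix.add_apply, vecMulVec_apply, vecMulVec_apply,
      h1, h2, smul_eq_mul]
    split_ifs <;> ring
  have hvu : v = v i • (Pi.single i 1 + u + u (dual i) • f) := by
    funext k
    simp only [Pi.smul_apply, Pi.add_apply, smul_eq_mul, f, u, Pi.single_apply]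
    by_cases h1 : k = i
    · subst h1
      simp [hii.symm]
    · by_cases h2 : k = dual i
      · subst h2
        simp [hii]
        field_simp
      · simp [h1, h2]
        field_simp
  have huv : u ⬝ᵥ (form l *ᵥ v) = v i * (c * u (dual i)) := by
    conv_lhs => rw [hvu]
    rw [mulVec_smul, mulVec_add, mulVec_add, mulVec_smul, dotProduct_smul, dotProduct_add,
      dotProduct_add, dotProduct_smul, huf, dotProduct_form_mulVec_self,
      dotProduct_form_mulVec_swap u, single_one_dotProduct, form_mulVec_apply]
    have : c = -sg i := sg_dual i
    rw [this]
    simp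
  have hNv : (c • (vecMulVec u f + vecMulVec f u) * form l) *ᵥ v
      = v i • (u + u (dual i) • f) := by
    rw [← mulVec_mulVec, smul_mulVec, add_mulVec, vecMulVec_mulVec, vecMulVec_mulVec, hf, huv]
    funext k
    simp only [Pi.smul_apply, Pi.add_apply, smul_eq_mul, MulOpposite.smul_eq_mul_unop,
      MulOpposite.unop_op]
    linear_combination (u k * v i + f k * (v i * u (dual i))) * hcc
  -- Strict upper triangularity holds because `u` is supported on indices below `i` and `*` reverses
  -- the order.
  have ht : ∀ k m, m ≤ k → (c • (vecMulVec u f + vecMulVec f u) * form l) k m = 0 := by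
    intro k m hmk
    have hu : ∀ k, i ≤ k → u k = 0 := by
      intro k hk
      rcases hk.eq_or_lt with h | h
      · rw [← h, hui]
      · exact hu0 k (hv k h)
    rw [hNe]
    have h1 : u k * (if m = i then 1 else 0) = 0 := by
      split_ifs with h
      · rw [hu k (h ▸ hmk), zero_mul]
      · rw [mul_zero]
    have h2 : (if k = dual i then u (dual m) else 0) = 0 := by
      split_ifs with h
      · refine hu _ (not_lt.1 fun h' => ?_)
        rw [dual_lt_iff, ← h] at h'
        exact absurd hmk (not_le.2 h')
      · rfl
    rw [h1, h2]
    simp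
  obtain ⟨b, hb, hbe⟩ := exists_borel_eq_one_sub hN ht
  refine ⟨b, hb, ?_, ?_, ?_, ?_, ?_⟩
  · intro k m hk hm
    rw [hbe, Matrix.sub_apply, hNe, if_neg hk, if_neg hm]
    simp
  · intro k hk hk'
    rw [hbe, Matrix.sub_apply, hNe, if_neg hk', if_pos rfl, one_apply_ne hk]
    simp only [u, if_neg hk, if_neg hk']
    linear_combination -(v k / v i) * hcc
  · intro k
    rw [hbe, Matrix.sub_apply, ht k k le_rfl]
    simp
  · intro m hm hvm k
    rw [hbe, Matrix.sub_apply, hNe, hu0 _ hvm, if_neg hm]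
    simp
  · rw [hbe, sub_mulVec, one_mulVec, hNv]
    conv_lhs => lhs; rw [hvu]
    funext k
    simp [Pi.single_apply]

/-! ### Localisation to an index set stable under `*`, and the torus -/

/-- The matrix is the identity outside of the indices in `A`. -/
def IsOneOff (A : Finset (Fin (2 * l))) (b : Matrix (Fin (2 * l)) (Fin (2 * l)) ℂ) : Prop :=
  ∀ k m, k ∉ A ∨ m ∉ A → b k m = (1 : Matrix _ _ ℂ) k m

theorem IsOneOff.mono {A A' : Finset (Fin (2 * l))} (h : A ⊆ A')
    {b : Matrix (Fin (2 * l)) (Fin (2 * l)) ℂ} (hb : IsOneOff A b) : IsOneOff A' b :=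
  fun k m hkm => hb k m (hkm.imp (fun h' => mt (@h k) h') (fun h' => mt (@h m) h'))

theorem IsOneOff.mul_apply_left {A : Finset (Fin (2 * l))}
    {b : Matrix (Fin (2 * l)) (Fin (2 * l)) ℂ} (hb : IsOneOff A b)
    (S : Matrix (Fin (2 * l)) (Fin (2 * l)) ℂ) {k : Fin (2 * l)} (hk : k ∉ A) (m : Fin (2 * l)) :
    (b * S) k m = S k m := by
  rw [mul_apply, Finset.sum_congr rfl fun a _ => by rw [hb k a (Or.inl hk)], ← mul_apply, one_mul]

theorem IsOneOff.mul_apply_right {A : Finset (Fin (2 * l))}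
    {b : Matrix (Fin (2 * l)) (Fin (2 * l)) ℂ} (hb : IsOneOff A b)
    (S : Matrix (Fin (2 * l)) (Fin (2 * l)) ℂ) (k : Fin (2 * l)) {m : Fin (2 * l)} (hm : m ∉ A) :
    (S * b) k m = S k m := by
  rw [mul_apply, Finset.sum_congr rfl fun a _ => by rw [hb a m (Or.inr hm)], ← mul_apply, mul_one]

theorem IsOneOff.mul {A : Finset (Fin (2 * l))} {b c : Matrix (Fin (2 * l)) (Fin (2 * l)) ℂ}
    (hb : IsOneOff A b) (hc : IsOneOff A c) : IsOneOff A (b * c) := by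
  rintro k m (h | h)
  · rw [hb.mul_apply_left _ h, hc k m (Or.inl h)]
  · rw [hc.mul_apply_right _ _ h, hb k m (Or.inr h)]

/-- The matrix is supported on the rows in `A`; for a symmetric matrix this means on `A × A`. -/
def SuppOn (A : Finset (Fin (2 * l))) (S : Matrix (Fin (2 * l)) (Fin (2 * l)) ℂ) : Prop :=
  ∀ k, k ∉ A → ∀ m, S k m = 0

theorem SuppOn.congr {A : Finset (Fin (2 * l))} {S b : Matrix (Fin (2 * l)) (Fin (2 * l)) ℂ}
    (hS : SuppOn A S) (hb : IsOneOff A b) : SuppOn A (b * S * bᵀ) := by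
  intro k hk m
  rw [mul_apply]
  refine Finset.sum_eq_zero fun a _ => ?_
  rw [hb.mul_apply_left _ hk, hS k hk, zero_mul]

/-- The clearing element differs from the identity only in column `i` and row `dual i`, where its
off-diagonal entries vanish wherever `v`, respectively `v ∘ dual`, does. -/
theorem exists_borel_clear_on (A : Finset (Fin (2 * l))) (hA : ∀ k ∈ A, dual k ∈ A)
    (v : Fin (2 * l) → ℂ) (hvA : ∀ k, k ∉ A → v k = 0) (i : Fin (2 * l)) (hi : v i ≠ 0)
    (hv : ∀ k, i < k → v k = 0) :
    ∃ b ∈ borel l, IsOneOff A b.val ∧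
      (∀ k m, k ≠ dual i → m ≠ i → b.val k m = (1 : Matrix _ _ ℂ) k m) ∧
      (∀ k, k ≠ i → k ≠ dual i → b.val k i = -(v k / v i)) ∧ (∀ k, b.val k k = 1) ∧
      (∀ m, m ≠ i → v (dual m) = 0 → ∀ k, b.val k m = (1 : Matrix _ _ ℂ) k m) ∧
      b.val *ᵥ v = Pi.single i (v i) := by
  obtain ⟨b, hb, h1, h2, h3, h4, h5⟩ := exists_borel_clear v i hi hv
  refine ⟨b, hb, ?_, h1, h2, h3, h4, h5⟩
  have hiA : i ∈ A := by
    by_contra h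
    exact hi (hvA i h)
  rintro k m (h | h)
  · have hk : k ≠ i := fun h' => h (h' ▸ hiA)
    have hk' : k ≠ dual i := fun h' => h (h' ▸ hA i hiA)
    by_cases hm : m = i
    · subst hm
      rw [h2 k hk hk', hvA k h, one_apply_ne hk]
      simp
    · exact h1 k m hk' hm
  · refine h4 m (fun h' => h (h' ▸ hiA)) (hvA _ fun h' => h ?_) k
    have := hA _ h'
    rwa [dual_dual] at this

/-- Rescaling by the torus. -/
theorem exists_borel_diagonal (d : Fin (2 * l) → ℂ) (hd : ∀ k, d k * d (dual k) = 1) :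
    ∃ b ∈ borel l, b.val = diagonal d := by
  have h1 : ∀ k, d (dual k) * d k = 1 := fun k => by rw [mul_comm, hd]
  refine ⟨⟨diagonal d, diagonal fun k => d (dual k), ?_, ?_⟩, ⟨?_, ?_⟩, rfl⟩
  · rw [diagonal_mul_diagonal, ← diagonal_one]
    simp only [hd]
  · rw [diagonal_mul_diagonal, ← diagonal_one]
    simp only [h1]
  · change (diagonal d)ᵀ * form l * diagonal d = form l
    ext i j
    rw [diagonal_transpose, mul_diagonal, diagonal_mul, form_apply]
    split_ifs with h
    · subst h
      linear_combination sg i * hd i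
    · simp
  · intro i j h
    exact diagonal_apply_ne _ h.ne'

/-- Only the coordinates `i` and `dual i` are rescaled, by inverse factors. When `j = i` the factor
enters squared, so a square root of `c` is needed. -/
theorem exists_borel_scale (A : Finset (Fin (2 * l))) (hA : ∀ k ∈ A, dual k ∈ A)
    {i j : Fin (2 * l)} (hi : i ∈ A) (hij : i ≠ dual j) {c : ℂ} (hc : c ≠ 0) :
    ∃ b ∈ borel l, IsOneOff A b.val ∧ ∃ d, b.val = diagonal d ∧ d i * d j = c := by
  obtain ⟨a, ha0, hac⟩ : ∃ a : ℂ, a ≠ 0 ∧ (if j = i then a * a else a) = c := by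
    split_ifs with h
    · obtain ⟨z, rfl⟩ := IsAlgClosed.exists_eq_mul_self c
      exact ⟨z, left_ne_zero_of_mul hc, rfl⟩
    · exact ⟨c, hc, rfl⟩
  let d : Fin (2 * l) → ℂ := fun k => if k = i then a else if k = dual i then a⁻¹ else 1
  have hii := dual_ne i
  obtain ⟨b, hb, hbd⟩ := exists_borel_diagonal d (by
    intro k
    by_cases h1 : k = i
    · subst h1; simp [d, hii, ha0]
    · have h1' : dual k ≠ dual i := fun h => h1 (Fin.rev_injective h)
      by_cases h2 : k = dual i
      · subst h2; simp [d, hii, ha0]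
      · have h2' : dual k ≠ i := fun h => h2 (eq_dual_comm.2 h.symm)
        simp only [d, if_neg h1, if_neg h2, if_neg h1', if_neg h2', mul_one])
  refine ⟨b, hb, ?_, d, hbd, ?_⟩
  · have hd : ∀ k, k ∉ A → d k = 1 := by
      intro k hk
      have h1 : k ≠ i := fun h => hk (h ▸ hi)
      have h2 : k ≠ dual i := fun h => hk (h ▸ hA i hi)
      simp only [d, if_neg h1, if_neg h2]
    intro k m h
    rw [hbd, diagonal_apply, one_apply]
    by_cases hkm : k = m
    · subst hkm
      rw [if_pos rfl, if_pos rfl, hd k (or_self_iff.1 h)]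
    · rw [if_neg hkm, if_neg hkm]
  · have hji : j ≠ dual i := fun h => hij (eq_dual_comm.2 h)
    by_cases h : j = i
    · subst h
      simpa [d] using hac
    · simpa [d, h, hji] using hac

/-! ### Producing a pivot -/

theorem congr_apply (b S : Matrix (Fin (2 * l)) (Fin (2 * l)) ℂ) (k i : Fin (2 * l)) :
    (b * S * bᵀ) k i = (b *ᵥ (S *ᵥ b i)) k := by
  rw [mul_assoc]
  rfl

/-- Row `i` has its only nonzero entry in column `j` and conversely. -/
def IsPivot (S : Matrix (Fin (2 * l)) (Fin (2 * l)) ℂ) (i j : Fin (2 * l)) : Prop :=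
  S i j ≠ 0 ∧ (∀ k, k ≠ j → S i k = 0) ∧ ∀ k, k ≠ i → S j k = 0

/-- An upper-triangular `b` only adds multiples of a row to itself and to the rows above it. -/
theorem rows_congr_eq_zero {S : Matrix (Fin (2 * l)) (Fin (2 * l)) ℂ} {i : Fin (2 * l)}
    (hi : ∀ k, i < k → ∀ m, S k m = 0) {b : GL (Fin (2 * l)) ℂ} (hb : b ∈ borel l)
    (k : Fin (2 * l)) (hk : i < k) (m : Fin (2 * l)) : (b.val * S * b.valᵀ) k m = 0 := by
  rw [congr_apply, mulVec, dotProduct]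
  refine Finset.sum_eq_zero fun a _ => ?_
  rcases lt_or_ge a k with h | h
  · rw [borel_apply_eq_zero hb h, zero_mul]
  · have : (S *ᵥ b.val m) a = 0 := by
      rw [mulVec, dotProduct]
      exact Finset.sum_eq_zero fun c _ => by rw [hi a (hk.trans_le h), zero_mul]
    rw [this, mul_zero]

/-- Clear the last nonzero row of `S` to a single entry. -/
theorem exists_borel_row (A : Finset (Fin (2 * l))) (hA : ∀ k ∈ A, dual k ∈ A)
    {S : Matrix (Fin (2 * l)) (Fin (2 * l)) ℂ} (hS : IsotropicSymm S) (hSA : SuppOn A S)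
    (h0 : S ≠ 0) :
    ∃ b ∈ borel l, IsOneOff A b.val ∧ ∃ i j, (b.val * S * b.valᵀ) i j ≠ 0 ∧
      (∀ k, k ≠ j → (b.val * S * b.valᵀ) i k = 0) ∧
      ∀ k, i < k → ∀ m, (b.val * S * b.valᵀ) k m = 0 := by
  classical
  obtain ⟨i, ⟨j₀, hj₀⟩, hi⟩ : ∃ i, (∃ j, S i j ≠ 0) ∧ ∀ k, i < k → ∀ m, S k m = 0 := by
    have hne : (Finset.univ.filter fun i => ∃ j, S i j ≠ 0).Nonempty := by
      by_contra h
      rw [Finset.not_nonempty_iff_eq_empty, Finset.filter_eq_empty_iff] at h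
      apply h0
      ext r c
      by_contra hrc
      exact h (Finset.mem_univ r) ⟨c, hrc⟩
    obtain ⟨i, hi, hmax⟩ := Finset.exists_max_image _ id hne
    refine ⟨i, (Finset.mem_filter.1 hi).2, fun k hk m => ?_⟩
    by_contra hkm
    exact absurd (hmax k (Finset.mem_filter.2 ⟨Finset.mem_univ k, m, hkm⟩)) (not_le.2 hk)
  obtain ⟨j, hj, hjmax⟩ : ∃ j, S i j ≠ 0 ∧ ∀ k, j < k → S i k = 0 := by
    have hne : (Finset.univ.filter fun j => S i j ≠ 0).Nonempty :=
      ⟨j₀, Finset.mem_filter.2 ⟨Finset.mem_univ _, hj₀⟩⟩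
    obtain ⟨j, hj, hmax⟩ := Finset.exists_max_image _ id hne
    refine ⟨j, (Finset.mem_filter.1 hj).2, fun k hk => ?_⟩
    by_contra hkm
    exact absurd (hmax k (Finset.mem_filter.2 ⟨Finset.mem_univ k, hkm⟩)) (not_le.2 hk)
  obtain ⟨b, hb, hbA, -, -, hdiag, -, hbv⟩ := exists_borel_clear_on A hA (S i)
    (fun k hk => by rw [← hS.symm.apply, hSA k hk]) j hj hjmax
  refine ⟨b, hb, hbA, i, j, ?_⟩
  -- Row `i` of `b` is zero to the left of `i`, and to the right of `i` it meets zero columns of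
  -- `S`. The right factor therefore leaves column `i` alone, and the left factor clears it.
  have hcol : ∀ k, (b.val * S * b.valᵀ) k i = (Pi.single j (S i j) : Fin (2 * l) → ℂ) k := by
    intro k
    rw [congr_apply, ← hbv]
    congr 2
    funext a
    rw [mulVec, dotProduct, Finset.sum_eq_single i]
    · rw [hdiag, mul_one, hS.symm.apply]
    · intro c _ hc
      rcases lt_or_gt_of_ne hc with h | h
      · rw [borel_apply_eq_zero hb h, mul_zero]
      · rw [← hS.symm.apply, hi c h, zero_mul]
    · simp
  have hS' := (hS.congr hb).symm
  refine ⟨?_, fun k hk => ?_, rows_congr_eq_zero hi hb⟩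
  · rw [← hS'.apply, hcol]
    simpa using hj
  · rw [← hS'.apply, hcol]
    simp [hk]

/-- Row `j` ends at column `i`, since the rows after `i` vanish, so it can be cleared towards `i`.
Isotropy ensures that this does not spoil row `i`. -/
theorem exists_borel_isPivot_of_row (A : Finset (Fin (2 * l))) (hA : ∀ k ∈ A, dual k ∈ A)
    {S : Matrix (Fin (2 * l)) (Fin (2 * l)) ℂ} (hS : IsotropicSymm S) (hSA : SuppOn A S)
    {i j : Fin (2 * l)} (hij : S i j ≠ 0) (hi : ∀ k, k ≠ j → S i k = 0)
    (hrow : ∀ k, i < k → ∀ m, S k m = 0) :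
    ∃ b ∈ borel l, IsOneOff A b.val ∧ IsPivot (b.val * S * b.valᵀ) i j := by
  have hji : S j i = S i j := hS.symm.apply i j
  by_cases hne : j = i
  · subst hne
    refine ⟨1, one_mem _, fun k m _ => rfl, ?_⟩
    simpa [IsPivot, hij] using hi
  have hdj := hS.dual_row_eq_zero hij hi
  have hij' : i ≠ dual j := fun h => hij (by rw [h, hdj])
  have hji' : j ≠ dual i := fun h => hij' (eq_dual_comm.1 h)
  -- The right factor `bᵀ` already removes half of the diagonal entry, so the vector to clear is row
  -- `j` with `S j j` halved: `S *ᵥ b j = y`.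
  let y : Fin (2 * l) → ℂ := fun k => S j k - if k = j then S j j / 2 else 0
  have hy0 : ∀ k, S j k = 0 → y k = 0 := by
    intro k hk
    simp only [y]
    split_ifs with h
    · subst h; rw [hk]; simp
    · rw [hk]; simp
  have hyi : y i = S i j := by simp [y, Ne.symm hne, hji]
  have hyj : y j = S j j / 2 := by simp only [y, if_pos]; ring
  obtain ⟨b, hb, hbA, h1, h2, hdiag, h3, hbv⟩ := exists_borel_clear_on A hA y
    (fun k hk => hy0 k (by rw [← hS.symm.apply, hSA k hk])) i (by rwa [hyi])
    (fun k hk => hy0 k (by rw [← hS.symm.apply, hrow k hk]))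
  have hbi : b.val i = Pi.single i 1 := by
    funext m
    by_cases hm : m = i
    · subst hm; rw [hdiag]; simp
    · rw [h1 i m (dual_ne i).symm hm, one_apply_ne (Ne.symm hm)]; simp [hm]
  have hbj : b.val j = Pi.single j 1 + Pi.single i (-(S j j / 2 / S i j)) := by
    funext m
    by_cases hm : m = i
    · subst hm; rw [h2 j hne hji', hyj, hyi]; simp [Ne.symm hne]
    · rw [h1 j m hji' hm, one_apply]; simp [hm, Pi.single_apply, eq_comm]
  have hSi : S *ᵥ Pi.single i 1 = Pi.single j (S i j) := by
    funext k
    rw [mulVec_single_one, col_apply, ← hS.symm.apply]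
    by_cases hk : k = j
    · subst hk; simp
    · rw [hi k hk]; simp [hk]
  have hcoli : ∀ k, (b.val * S * b.valᵀ) k i = (Pi.single j (S i j) : Fin (2 * l) → ℂ) k := by
    intro k
    rw [congr_apply, hbi, hSi, mulVec_single]
    -- By isotropy `y` vanishes at `dual j`, so `b` fixes the `j`-th basis vector.
    have := h3 j hne (hy0 _ (by rw [← hS.symm.apply, hdj])) k
    simp only [Pi.smul_apply, col_apply, this, one_apply, Pi.single_apply]
    simp
  have hcolj : ∀ k, (b.val * S * b.valᵀ) k j = (Pi.single i (S i j) : Fin (2 * l) → ℂ) k := by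
    intro k
    rw [congr_apply, hbj, ← hyi, ← hbv]
    congr 2
    rw [mulVec_add]
    have : (Pi.single i (-(S j j / 2 / y i)) : Fin (2 * l) → ℂ)
        = (-(S j j / 2 / y i)) • Pi.single i 1 := by
      rw [← Pi.single_smul]; simp
    rw [this, mulVec_smul, hSi, mulVec_single_one, hyi]
    funext a
    simp only [Pi.add_apply, col_apply, Pi.smul_apply, smul_eq_mul, y, hS.symm.apply j a,
      Pi.single_apply]
    split_ifs
    · field_simp
      ring
    · ring
  have hS' := (hS.congr hb).symm
  refine ⟨b, hb, hbA, ?_, fun k hk => ?_, fun k hk => ?_⟩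
  · rw [← hS'.apply, hcoli]
    simpa using hij
  · rw [← hS'.apply, hcoli]
    simp [hk]
  · rw [← hS'.apply, hcolj]
    simp [hk]

theorem congr_mul (b c : GL (Fin (2 * l)) ℂ) (S : Matrix (Fin (2 * l)) (Fin (2 * l)) ℂ) :
    (b * c).val * S * (b * c).valᵀ = b.val * (c.val * S * c.valᵀ) * b.valᵀ := by
  rw [Units.val_mul, transpose_mul]
  simp only [mul_assoc]

/-- Every nonzero isotropic symmetric matrix acquires a pivot with a prescribed entry. -/
theorem exists_borel_isPivot (A : Finset (Fin (2 * l))) (hA : ∀ k ∈ A, dual k ∈ A)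
    {S : Matrix (Fin (2 * l)) (Fin (2 * l)) ℂ} (hS : IsotropicSymm S) (hSA : SuppOn A S)
    (h0 : S ≠ 0) :
    ∃ i ∈ A, ∃ j ∈ A, i ≠ dual j ∧ ∀ c : ℂ, c ≠ 0 →
    ∃ b ∈ borel l, IsOneOff A b.val ∧ IsPivot (b.val * S * b.valᵀ) i j ∧
      (b.val * S * b.valᵀ) i j = c := by
  obtain ⟨b₁, hb₁, hbA₁, i, j, hij, hi, hrow⟩ := exists_borel_row A hA hS hSA h0
  obtain ⟨b₂, hb₂, hbA₂, hp⟩ := exists_borel_isPivot_of_row A hA (hS.congr hb₁)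
    (hSA.congr hbA₁) hij hi hrow
  have hS₁ := (hS.congr hb₁).congr hb₂
  have hA₁ := (hSA.congr hbA₁).congr hbA₂
  have hb₂₁ := mul_mem hb₂ hb₁
  have hbA₂₁ := hbA₂.mul hbA₁
  rw [← Units.val_mul] at hbA₂₁
  rw [← congr_mul] at hS₁ hA₁ hp
  generalize b₂ * b₁ = b at *
  have hiA : i ∈ A := by
    by_contra h
    exact hp.1 (hA₁ i h j)
  have hjA : j ∈ A := by
    by_contra h
    exact hp.1 (by rw [← hS₁.symm.apply, hA₁ j h i])
  have hij : i ≠ dual j := fun h => hp.1 (by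
    have := hS₁.dual_row_eq_zero hp.1 hp.2.1 j
    rwa [← h] at this)
  -- The position is fixed before `c`, because the sign required later depends on the arrow at that
  -- position.
  refine ⟨i, hiA, j, hjA, hij, fun c hc => ?_⟩
  obtain ⟨t, ht, htA, d, htd, hd⟩ := exists_borel_scale A hA hiA hij (div_ne_zero hc hp.1)
  have key : ∀ k m, ((t * b).val * S * (t * b).valᵀ) k m
      = d k * d m * (b.val * S * b.valᵀ) k m := by
    intro k m
    rw [congr_mul, htd, diagonal_transpose, mul_diagonal, diagonal_mul]
    ring
  have hkij : ((t * b).val * S * (t * b).valᵀ) i j = c := by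
    rw [key, hd, div_mul_cancel₀ _ hp.1]
  refine ⟨t * b, mul_mem ht hb₂₁, ?_, ⟨?_, fun k hk => ?_, fun k hk => ?_⟩, hkij⟩
  · rw [Units.val_mul]
    exact htA.mul hbA₂₁
  · rwa [hkij]
  · rw [key, hp.2.1 k hk, mul_zero]
  · rw [key, hp.2.2 k hk, mul_zero]

/-! ### Splitting off a pivot -/

/-- The symmetric matrix with entry `1` at the positions `(i, j)` and `(j, i)`. -/
def symmUnit (i j : Fin (2 * l)) : Matrix (Fin (2 * l)) (Fin (2 * l)) ℂ :=
  Matrix.of fun r m => if (r = i ∧ m = j) ∨ (r = j ∧ m = i) then 1 else 0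

/-- A pivot splits off, leaving an isotropic symmetric matrix on the remaining indices. -/
theorem IsPivot.exists_split {A : Finset (Fin (2 * l))}
    {S : Matrix (Fin (2 * l)) (Fin (2 * l)) ℂ} (hS : IsotropicSymm S) (hSA : SuppOn A S)
    {i j : Fin (2 * l)} (hp : IsPivot S i j) :
    ∃ S', IsotropicSymm S' ∧ SuppOn (A \ {i, j, dual i, dual j}) S' ∧
      S = S i j • symmUnit i j + S' := by
  classical
  have hji : S j i = S i j := hS.symm.apply i j
  have hdj := hS.dual_row_eq_zero hp.1 hp.2.1
  have hdi := hS.dual_row_eq_zero (i := j) (j := i) (by rw [hji]; exact hp.1) hp.2.2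
  let P : Fin (2 * l) → Prop := fun k => k = i ∨ k = j
  have hrow : ∀ k m, P k → ¬ P m → S k m = 0 := by
    rintro k m (rfl | rfl) hm
    · exact hp.2.1 m fun h => hm (Or.inr h)
    · exact hp.2.2 m fun h => hm (Or.inl h)
  let S' : Matrix (Fin (2 * l)) (Fin (2 * l)) ℂ :=
    Matrix.of fun k m => if P k ∨ P m then 0 else S k m
  have hS' : ∀ k m, S' k m = if P k ∨ P m then 0 else S k m := fun _ _ => rfl
  have hr : ∀ k m, ¬ P k → S' k m = S k m := by
    intro k m hk
    rw [hS']
    split_ifs with h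
    · have hm : P m := h.resolve_left hk
      rw [← hS.symm.apply, hrow m k hm hk]
    · rfl
  have hsymm : S'.IsSymm := by
    ext k m
    rw [transpose_apply, hS', hS', hS.symm.apply]
    simp only [or_comm]
  have hz : ∀ k, P k → ∀ m, S' k m = 0 := by
    intro k hk m
    rw [hS', if_pos (Or.inl hk)]
  refine ⟨S', ⟨hsymm, ?_⟩, ?_, ?_⟩
  · ext k m
    by_cases hk : P k
    · rw [mul_assoc, mul_apply, Matrix.zero_apply]
      exact Finset.sum_eq_zero fun a _ => by rw [hz k hk, zero_mul]
    by_cases hm : P m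
    · rw [mul_apply, Matrix.zero_apply]
      exact Finset.sum_eq_zero fun a _ => by rw [← hsymm.apply, hz m hm, mul_zero]
    -- Away from `i` and `j` the rows of `S` and `S'` agree, so isotropy is inherited entry by
    -- entry.
    have h0 := congrFun (congrFun hS.isotropic k) m
    rw [← h0, mul_apply, mul_apply]
    refine Finset.sum_congr rfl fun a _ => ?_
    rw [mul_form_apply, mul_form_apply, hr k _ hk, ← hsymm.apply, hr m a hm, hS.symm.apply a m]
  · intro k hk m
    by_cases hP : P k
    · exact hz k hP m
    rw [hr k m hP]
    rw [Finset.mem_sdiff, not_and_or, not_not] at hk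
    rcases hk with hk | hk
    · exact hSA k hk m
    · simp only [Finset.mem_insert, Finset.mem_singleton] at hk
      rcases hk with rfl | rfl | rfl | rfl
      · exact absurd (Or.inl rfl) hP
      · exact absurd (Or.inr rfl) hP
      · exact hdi m
      · exact hdj m
  · ext k m
    rw [Matrix.add_apply, Matrix.smul_apply, symmUnit, of_apply, smul_eq_mul]
    by_cases hk : P k
    · rw [hz k hk, add_zero]
      split_ifs with h
      · rcases h with ⟨rfl, rfl⟩ | ⟨rfl, rfl⟩
        · simp
        · rw [hji, mul_one]
      · rw [mul_zero]
        rcases hk with rfl | rfl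
        · exact hp.2.1 m fun h' => h (Or.inl ⟨rfl, h'⟩)
        · exact hp.2.2 m fun h' => h (Or.inr ⟨rfl, h'⟩)
    · rw [hr k m hk, if_neg, mul_zero, zero_add]
      rintro (h | h)
      · exact hk (Or.inl h.1)
      · exact hk (Or.inr h.1)

/-! ### Pivot positions and arrows -/

/-- The vertex below an index. -/
def vtx (k : Fin (2 * l)) : Fin l :=
  if h : k.val < l then ⟨k.val, h⟩ else ⟨2 * l - (k.val + 1), by omega⟩

theorem val_vtx (k : Fin (2 * l)) :
    (vtx k).val = if k.val < l then k.val else 2 * l - (k.val + 1) := by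
  unfold vtx
  split_ifs <;> rfl

theorem val_idx (i : Fin l) : (idx i).val = i.val := rfl

theorem vtx_idx (i : Fin l) : vtx (idx i) = i := by
  ext
  rw [val_vtx, val_idx, if_pos i.isLt]

theorem vtx_dual (k : Fin (2 * l)) : vtx (dual k) = vtx k := by
  ext
  rw [val_vtx, val_vtx, val_dual]
  have := k.isLt
  split_ifs <;> omega

theorem eq_idx_or (k : Fin (2 * l)) : ∃ i : Fin l, k = idx i ∨ k = dual (idx i) := by
  refine ⟨vtx k, ?_⟩
  by_cases h : k.val < l
  · left
    ext
    rw [val_idx, val_vtx, if_pos h]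
  · right
    ext
    have := k.isLt
    rw [val_dual, val_idx, val_vtx, if_neg h]
    omega

theorem sg_idx (i : Fin l) : sg (idx i) = 1 := by
  rw [sg, if_pos]
  exact i.isLt

theorem idx_ne_dual_idx (i j : Fin l) : idx i ≠ dual (idx j) := by
  intro h
  have := congrArg Fin.val h
  rw [val_dual, val_idx, val_idx] at this
  omega

theorem idx_injective : Function.Injective (idx : Fin l → Fin (2 * l)) := Fin.castLE_injective _

theorem E_apply (a b r c : Fin (2 * l)) : E a b r c = if a = r ∧ b = c then 1 else 0 :=
  single_apply a b 1 r c

theorem E_apply_same (a b : Fin (2 * l)) : E a b a b = 1 := by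
  rw [E_apply, if_pos ⟨rfl, rfl⟩]

theorem E_apply_of_row_ne {a r : Fin (2 * l)} (h : a ≠ r) (b c : Fin (2 * l)) :
    E a b r c = 0 := by
  rw [E_apply, if_neg fun h' => h h'.1]

theorem E_mul_form (a b : Fin (2 * l)) : E a b * form l = sg b • E a (dual b) := by
  ext r c
  rw [mul_form_apply, Matrix.smul_apply, E_apply, E_apply, smul_eq_mul]
  have : b = dual c ↔ dual b = c := by rw [eq_dual_comm, eq_comm]
  simp only [← this]
  by_cases h : a = r ∧ b = dual c
  · rw [if_pos h, h.2]
    ring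
  · rw [if_neg h]
    ring

theorem symmUnit_self (i : Fin (2 * l)) : symmUnit i i = E i i := by
  ext r c
  rw [E_apply, symmUnit, of_apply]
  simp only [or_self, eq_comm]

theorem symmUnit_of_ne {i j : Fin (2 * l)} (h : i ≠ j) : symmUnit i j = E i j + E j i := by
  ext r c
  rw [Matrix.add_apply, E_apply, E_apply, symmUnit, of_apply]
  by_cases h1 : i = r
  · subst h1
    simp [h, Ne.symm h, eq_comm]
  · simp [h1, Ne.symm h1, eq_comm]

theorem symmUnit_comm (i j : Fin (2 * l)) : symmUnit i j = symmUnit j i := by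
  ext r c
  rw [symmUnit, symmUnit, of_apply, of_apply]
  simp only [or_comm]

/-- Every admissible pivot position is the position of an arrow. -/
theorem exists_arrow (i j : Fin (2 * l)) (hij : i ≠ dual j) :
    ∃ (a : Arrow l) (c : ℂ), c ≠ 0 ∧ (∀ v, a.Touches v ↔ v = vtx i ∨ v = vtx j) ∧
      (∀ s, a ≠ .plain s s) ∧ a.matrix = (c • symmUnit i j) * form l := by
  have plain_case : ∀ s t : Fin l, s ≠ t →
      ∃ (a : Arrow l) (c : ℂ), c ≠ 0 ∧
      (∀ v, a.Touches v ↔ v = s ∨ v = t) ∧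
      (∀ s, a ≠ .plain s s) ∧ a.matrix = (c • symmUnit (dual (idx s)) (idx t)) * form l := by
    intro s t hst
    refine ⟨.plain s t, -1, by norm_num, fun v => Iff.rfl, ?_, ?_⟩
    · rintro r ⟨⟩
      exact hst rfl
    · rw [symmUnit_of_ne (idx_ne_dual_idx t s).symm, smul_mul_assoc, add_mul, E_mul_form,
        E_mul_form, sg_dual, sg_idx, sg_idx, dual_dual, Arrow.matrix]
      module
  -- The halves containing `i` and `j` decide the arrow. Both in the first half give a
  -- counterclockwise loop or a dotted arrow towards the smaller vertex; mixed halves give an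
  -- undotted arrow; both in the second half give a clockwise loop or a dotted arrow towards the
  -- larger vertex.
  obtain ⟨s, rfl | rfl⟩ := eq_idx_or i <;> obtain ⟨t, rfl | rfl⟩ := eq_idx_or j
  · rw [vtx_idx, vtx_idx]
    by_cases hst : s = t
    · subst hst
      refine ⟨.dottedLoopCcw s, 1, one_ne_zero, fun v => (or_self_iff).symm, nofun, ?_⟩
      rw [one_smul, symmUnit_self, E_mul_form, sg_idx, one_smul, Arrow.matrix]
    · have hne : idx s ≠ idx t := idx_injective.ne hst
      rcases lt_or_gt_of_ne hst with h | h
      · refine ⟨.dotted t s (Ne.symm hst), 1, one_ne_zero, fun v => or_comm, nofun, ?_⟩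
        rw [one_smul, symmUnit_of_ne hne, add_mul, E_mul_form, E_mul_form, sg_idx,
          sg_idx, one_smul, one_smul, Arrow.matrix, if_pos h]
      · refine ⟨.dotted s t hst, 1, one_ne_zero, fun v => Iff.rfl, nofun, ?_⟩
        rw [one_smul, symmUnit_of_ne hne, add_mul, E_mul_form, E_mul_form, sg_idx,
          sg_idx, one_smul, one_smul, Arrow.matrix, if_pos h, add_comm]
  · rw [symmUnit_comm, vtx_idx, vtx_dual, vtx_idx]
    have hst : t ≠ s := by
      rintro rfl
      exact hij (dual_dual _).symm
    simpa only [or_comm] using plain_case t s hst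
  · rw [vtx_idx, vtx_dual, vtx_idx]
    refine plain_case s t ?_
    rintro rfl
    exact hij rfl
  · rw [vtx_dual, vtx_dual, vtx_idx, vtx_idx]
    by_cases hst : s = t
    · subst hst
      refine ⟨.dottedLoopCw s, -1, by norm_num, fun v => (or_self_iff).symm, nofun, ?_⟩
      rw [symmUnit_self, smul_mul_assoc, E_mul_form, sg_dual, sg_idx, dual_dual,
        Arrow.matrix]
      module
    · have hne : dual (idx s) ≠ dual (idx t) := fun h => hst (idx_injective (Fin.rev_injective h))
      rcases lt_or_gt_of_ne hst with h | h
      · refine ⟨.dotted s t hst, -1, by norm_num, fun v => Iff.rfl, nofun, ?_⟩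
        rw [symmUnit_of_ne hne, smul_mul_assoc, add_mul, E_mul_form, E_mul_form,
          sg_dual, sg_dual, sg_idx, sg_idx, dual_dual, dual_dual, Arrow.matrix,
          if_neg (not_lt.2 h.le)]
        module
      · refine ⟨.dotted t s (Ne.symm hst), -1, by norm_num, fun v => or_comm, nofun, ?_⟩
        rw [symmUnit_of_ne hne, smul_mul_assoc, add_mul, E_mul_form, E_mul_form,
          sg_dual, sg_dual, sg_idx, sg_idx, dual_dual, dual_dual, Arrow.matrix,
          if_neg (not_lt.2 h.le)]
        module

theorem idx_vtx (k : Fin (2 * l)) : idx (vtx k) = k ∨ idx (vtx k) = dual k := by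
  obtain ⟨s, rfl | rfl⟩ := eq_idx_or k
  · left; rw [vtx_idx]
  · right; rw [vtx_dual, vtx_idx, dual_dual]

/-! ### Every orbit contains the matrix of a pattern -/

/-- Elements of `B` supported away from `i` and `j` fix the corresponding symmetric unit. -/
theorem congr_symmUnit {A : Finset (Fin (2 * l))} {b : Matrix (Fin (2 * l)) (Fin (2 * l)) ℂ}
    (hb : IsOneOff A b) {i j : Fin (2 * l)} (hi : i ∉ A) (hj : j ∉ A) :
    b * symmUnit i j * bᵀ = symmUnit i j := by
  have h : b * symmUnit i j = symmUnit i j := by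
    conv_rhs => rw [← one_mul (symmUnit i j)]
    ext r c
    rw [mul_apply, mul_apply]
    refine Finset.sum_congr rfl fun a _ => ?_
    by_cases ha : a ∈ A
    · have h1 : a ≠ i := fun h => hi (h ▸ ha)
      have h2 : a ≠ j := fun h => hj (h ▸ ha)
      simp [symmUnit, h1, h2]
    · rw [hb r a (Or.inr ha)]
  have ht : (symmUnit i j)ᵀ = symmUnit i j := by
    ext r c
    rw [transpose_apply, symmUnit, of_apply, of_apply]
    simp only [or_comm, and_comm]
  calc b * symmUnit i j * bᵀ = (b * (symmUnit i j)ᵀ)ᵀ := by rw [h, transpose_mul,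
        transpose_transpose]
    _ = symmUnit i j := by rw [ht, h, ht]

/-- Every isotropic symmetric matrix is moved by `B` to the matrix of a pattern. -/
theorem exists_solp (A : Finset (Fin (2 * l))) :
    (∀ k ∈ A, dual k ∈ A) → ∀ S : Matrix (Fin (2 * l)) (Fin (2 * l)) ℂ,
    IsotropicSymm S → SuppOn A S →
    ∃ b ∈ borel l, IsOneOff A b.val ∧ ∃ p : Solp l,
      (∀ a ∈ p.arrows, ∀ v, a.Touches v → idx v ∈ A) ∧
      b.val * S * b.valᵀ * form l = p.matrix := by
  classical
  induction A using Finset.strongInduction with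
  | H A ih =>
  intro hA S hS hSA
  by_cases h0 : S = 0
  · subst h0
    refine ⟨1, one_mem _, fun _ _ _ => rfl, ⟨∅, by simp, by simp⟩, by simp, ?_⟩
    simp [Solp.matrix]
  obtain ⟨i, hi, j, hj, hij, H⟩ := exists_borel_isPivot A hA hS hSA h0
  obtain ⟨a, c, hc, hat, hal, ham⟩ := exists_arrow i j hij
  obtain ⟨b₁, hb₁, hbA₁, hp, hpc⟩ := H c hc
  obtain ⟨S', hS', hSA', hsplit⟩ := hp.exists_split (hS.congr hb₁) (hSA.congr hbA₁)
  have hsub : A \ {i, j, dual i, dual j} ⊆ A := Finset.sdiff_subset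
  have hi' : i ∉ A \ {i, j, dual i, dual j} := by simp
  have hj' : j ∉ A \ {i, j, dual i, dual j} := by simp
  have hdi' : dual i ∉ A \ {i, j, dual i, dual j} := by simp
  have hdj' : dual j ∉ A \ {i, j, dual i, dual j} := by simp
  have hA' : ∀ k ∈ A \ {i, j, dual i, dual j}, dual k ∈ A \ {i, j, dual i, dual j} := by
    intro k hk
    simp only [Finset.mem_sdiff, Finset.mem_insert, Finset.mem_singleton, not_or] at hk ⊢
    refine ⟨hA k hk.1, fun h => hk.2.2.2.1 ?_, fun h => hk.2.2.2.2 ?_,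
      fun h => hk.2.1 (Fin.rev_injective h), fun h => hk.2.2.1 (Fin.rev_injective h)⟩
    · rw [← h, dual_dual]
    · rw [← h, dual_dual]
  have hss : A \ {i, j, dual i, dual j} ⊂ A :=
    (Finset.ssubset_iff_of_subset hsub).2 ⟨i, hi, hi'⟩
  obtain ⟨b₂, hb₂, hbA₂, p, hpt, hpm⟩ := ih _ hss hA' S' hS' hSA'
  -- All four indices of the pivot are removed, so the new arrow shares no vertex with the pattern
  -- found on the remaining indices.
  have htouch : ∀ v, a.Touches v → idx v ∈ A ∧ idx v ∉ A \ {i, j, dual i, dual j} := by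
    intro v hv
    rcases (hat v).1 hv with rfl | rfl
    · rcases idx_vtx i with h | h <;> rw [h]
      · exact ⟨hi, hi'⟩
      · exact ⟨hA i hi, hdi'⟩
    · rcases idx_vtx j with h | h <;> rw [h]
      · exact ⟨hj, hj'⟩
      · exact ⟨hA j hj, hdj'⟩
  have hdisj : ∀ v, ∀ a' ∈ p.arrows, a.Touches v → ¬ a'.Touches v := fun v a' ha' hv hv' =>
    (htouch v hv).2 (hpt a' ha' v hv')
  have hap : a ∉ p.arrows := fun h =>
    hdisj (vtx i) a h ((hat _).2 (Or.inl rfl)) ((hat _).2 (Or.inl rfl))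
  refine ⟨b₂ * b₁, mul_mem hb₂ hb₁, ?_, ⟨insert a p.arrows, ?_, ?_⟩, ?_, ?_⟩
  · rw [Units.val_mul]
    exact (hbA₂.mono hsub).mul hbA₁
  · intro v a₁ h₁ a₂ h₂ hv₁ hv₂
    rcases Finset.mem_insert.1 h₁ with rfl | h₁' <;> rcases Finset.mem_insert.1 h₂ with rfl | h₂'
    · rfl
    · exact absurd hv₂ (hdisj v _ h₂' hv₁)
    · exact absurd hv₁ (hdisj v _ h₁' hv₂)
    · exact p.touched_once v _ h₁' _ h₂' hv₁ hv₂
  · intro s hs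
    rcases Finset.mem_insert.1 hs with h | h
    · exact hal s h.symm
    · exact p.no_plain_loop s h
  · intro a' ha' v hv
    rcases Finset.mem_insert.1 ha' with rfl | h
    · exact (htouch v hv).1
    · exact hsub (hpt a' h v hv)
  -- The second element is the identity off the remaining indices and so preserves the pivot.
  · rw [congr_mul, hsplit, hpc, mul_add, add_mul, add_mul, hpm, mul_smul_comm, smul_mul_assoc,
      congr_symmUnit hbA₂ hi' hj']
    change _ = ∑ a ∈ insert a p.arrows, a.matrix
    rw [Finset.sum_insert hap, ham, Solp.matrix]

/-! ### Supports of the representatives -/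

/-- The positions of the nonzero entries of the matrix of an arrow. -/
def Arrow.Entry (r c : ℕ) : Arrow l → Prop
  | .plain s t => (r = t.val ∧ c = s.val) ∨
      (r + s.val + 1 = 2 * l ∧ c + t.val + 1 = 2 * l)
  | .dotted s t _ => (t < s ∧ ((r = t.val ∧ c + s.val + 1 = 2 * l) ∨
        (r = s.val ∧ c + t.val + 1 = 2 * l))) ∨
      (s < t ∧ ((r + t.val + 1 = 2 * l ∧ c = s.val) ∨ (r + s.val + 1 = 2 * l ∧ c = t.val)))
  | .dottedLoopCcw i => r = i.val ∧ c + i.val + 1 = 2 * l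
  | .dottedLoopCw i => r + i.val + 1 = 2 * l ∧ c = i.val

theorem idx_eq_iff (i : Fin l) (k : Fin (2 * l)) : idx i = k ↔ k.val = i.val := by
  rw [Fin.ext_iff, val_idx, eq_comm]

theorem dual_idx_eq_iff (i : Fin l) (k : Fin (2 * l)) :
    dual (idx i) = k ↔ k.val + i.val + 1 = 2 * l := by
  rw [Fin.ext_iff, val_dual, val_idx]
  omega

theorem Arrow.entry_of_ne_zero {a : Arrow l} {r c : Fin (2 * l)} (h : a.matrix r c ≠ 0) :
    a.Entry r.val c.val := by
  contrapose! h
  cases a with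
  | plain s t =>
    rw [Entry, not_or] at h
    rw [Arrow.matrix, Matrix.sub_apply, E_apply, E_apply]
    simp only [idx_eq_iff, dual_idx_eq_iff]
    rw [if_neg h.1, if_neg h.2, sub_zero]
  | dotted s t hst =>
    rw [Entry, not_or] at h
    rw [Arrow.matrix]
    split_ifs with hlt
    · rw [Matrix.add_apply, E_apply, E_apply]
      simp only [idx_eq_iff, dual_idx_eq_iff]
      rw [if_neg fun h' => h.1 ⟨hlt, Or.inl h'⟩,
        if_neg fun h' => h.1 ⟨hlt, Or.inr h'⟩, add_zero]
    · have hlt' : s < t := lt_of_le_of_ne (not_lt.1 hlt) hst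
      rw [Matrix.add_apply, E_apply, E_apply]
      simp only [idx_eq_iff, dual_idx_eq_iff]
      rw [if_neg fun h' => h.2 ⟨hlt', Or.inl h'⟩,
        if_neg fun h' => h.2 ⟨hlt', Or.inr h'⟩, add_zero]
  | dottedLoopCcw i =>
    rw [Entry] at h
    rw [Arrow.matrix, E_apply]
    simp only [idx_eq_iff, dual_idx_eq_iff]
    rw [if_neg h]
  | dottedLoopCw i =>
    rw [Entry] at h
    rw [Arrow.matrix, E_apply]
    simp only [idx_eq_iff, dual_idx_eq_iff]
    rw [if_neg h]

theorem Arrow.exists_ne_zero (a : Arrow l) : ∃ r c, a.matrix r c ≠ 0 := by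
  cases a with
  | plain s t =>
    refine ⟨idx t, idx s, ?_⟩
    rw [Arrow.matrix, Matrix.sub_apply, E_apply_same, E_apply_of_row_ne
      (idx_ne_dual_idx t s).symm]
    norm_num
  | dotted s t hst =>
    have hne : idx s ≠ idx t := idx_injective.ne hst
    have hne' : dual (idx s) ≠ dual (idx t) := fun h => hne (Fin.rev_injective h)
    rw [Arrow.matrix]
    split_ifs with hlt
    · refine ⟨idx t, dual (idx s), ?_⟩
      rw [Matrix.add_apply, E_apply_same, E_apply_of_row_ne hne]
      norm_num
    · refine ⟨dual (idx t), idx s, ?_⟩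
      rw [Matrix.add_apply, E_apply_same, E_apply_of_row_ne hne']
      norm_num
  | dottedLoopCcw i =>
    refine ⟨idx i, dual (idx i), ?_⟩
    rw [Arrow.matrix, E_apply_same]
    norm_num
  | dottedLoopCw i =>
    refine ⟨dual (idx i), idx i, ?_⟩
    rw [Arrow.matrix, E_apply_same]
    norm_num

theorem Arrow.Entry.touches {a : Arrow l} {r c : Fin (2 * l)} (h : a.Entry r.val c.val) :
    a.Touches (vtx r) ∧ a.Touches (vtx c) := by
  have hr := val_vtx r
  have hc := val_vtx c
  cases a <;> simp only [Entry, Touches, Fin.ext_iff, Fin.lt_def] at h ⊢ <;>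
    split_ifs at hr hc <;> omega

/-- The halves of `r` and `c` reveal the type of arrow, and the positions within them its ends.
Hence contributions of different arrows never overlap, and a pattern can be read off its support. -/
theorem Arrow.Entry.unique {a a' : Arrow l} {r c : ℕ} (h : a.Entry r c) (h' : a'.Entry r c) :
    a = a' := by
  cases a <;> cases a' <;>
    simp only [Entry, Fin.lt_def, plain.injEq, dotted.injEq, dottedLoopCcw.injEq,
      dottedLoopCw.injEq, Fin.ext_iff, reduceCtorEq] at h h' ⊢ <;> omega

theorem Arrow.Entry.row {a : Arrow l} (ha : ∀ s, a ≠ .plain s s) {r c c' : ℕ} (h : a.Entry r c)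
    (h' : a.Entry r c') : c = c' := by
  cases a with
  | plain s t =>
    simp only [Entry] at h h'
    omega
  | dotted s t hst =>
    simp only [Entry, Fin.lt_def] at h h'
    omega
  | dottedLoopCcw i =>
    simp only [Entry] at h h'
    omega
  | dottedLoopCw i =>
    simp only [Entry] at h h'
    omega

theorem Arrow.Entry.col {a : Arrow l} (ha : ∀ s, a ≠ .plain s s) {r r' c : ℕ} (h : a.Entry r c)
    (h' : a.Entry r' c) : r = r' := by
  cases a with
  | plain s t =>
    simp only [Entry] at h h'
    omega
  | dotted s t hst =>
    simp only [Entry, Fin.lt_def] at h h'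
    omega
  | dottedLoopCcw i =>
    simp only [Entry] at h h'
    omega
  | dottedLoopCw i =>
    simp only [Entry] at h h'
    omega

/-- This is why a single arrow squares to zero; an undotted loop would have diagonal entries. -/
theorem Arrow.Entry.not_comp {a : Arrow l} (ha : ∀ s, a ≠ .plain s s) {r c d : ℕ}
    (h : a.Entry r c) : ¬ a.Entry c d := by
  intro h'
  cases a with
  | plain s t =>
    have : s.val ≠ t.val := fun hst => ha s (by rw [Fin.ext hst])
    simp only [Entry] at h h'
    omega
  | dotted s t hst =>
    simp only [Entry, Fin.lt_def] at h h'
    omega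
  | dottedLoopCcw i =>
    simp only [Entry] at h h'
    omega
  | dottedLoopCw i =>
    simp only [Entry] at h h'
    omega

theorem Solp.ne_plain (p : Solp l) {a : Arrow l} (ha : a ∈ p.arrows) (s : Fin l) :
    a ≠ .plain s s := by
  rintro rfl
  exact p.no_plain_loop s ha

theorem Solp.exists_entry (p : Solp l) {r c : Fin (2 * l)} (h : p.matrix r c ≠ 0) :
    ∃ a ∈ p.arrows, a.Entry r.val c.val := by
  rw [Solp.matrix, Matrix.sum_apply] at h
  obtain ⟨a, ha, hne⟩ := Finset.exists_ne_zero_of_sum_ne_zero h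
  exact ⟨a, ha, Arrow.entry_of_ne_zero hne⟩

theorem Solp.matrix_apply (p : Solp l) {a : Arrow l} (ha : a ∈ p.arrows) {r c : Fin (2 * l)}
    (h : a.Entry r.val c.val) : p.matrix r c = a.matrix r c := by
  rw [Solp.matrix, Matrix.sum_apply, Finset.sum_eq_single a]
  · intro a' _ hne
    by_contra h'
    exact hne ((Arrow.entry_of_ne_zero h').unique h)
  · exact fun h' => absurd ha h'

/-- Both entries come from the unique arrow touching the vertex below `r`. -/
theorem Solp.row (p : Solp l) {r c c' : Fin (2 * l)} (h : p.matrix r c ≠ 0)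
    (h' : p.matrix r c' ≠ 0) : c = c' := by
  obtain ⟨a, ha, he⟩ := p.exists_entry h
  obtain ⟨a', ha', he'⟩ := p.exists_entry h'
  obtain rfl := p.touched_once _ a ha a' ha' he.touches.1 he'.touches.1
  exact Fin.ext (he.row (p.ne_plain ha) he')

theorem Solp.col (p : Solp l) {r r' c : Fin (2 * l)} (h : p.matrix r c ≠ 0)
    (h' : p.matrix r' c ≠ 0) : r = r' := by
  obtain ⟨a, ha, he⟩ := p.exists_entry h
  obtain ⟨a', ha', he'⟩ := p.exists_entry h'
  obtain rfl := p.touched_once _ a ha a' ha' he.touches.2 he'.touches.2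
  exact Fin.ext (he.col (p.ne_plain ha) he')

theorem Solp.arrows_subset {p q : Solp l}
    (h : ∀ r c, p.matrix r c ≠ 0 → q.matrix r c ≠ 0) : p.arrows ⊆ q.arrows := by
  intro a ha
  obtain ⟨r, c, hne⟩ := a.exists_ne_zero
  have he := Arrow.entry_of_ne_zero hne
  rw [← p.matrix_apply ha he] at hne
  obtain ⟨a', ha', he'⟩ := q.exists_entry (h r c hne)
  rwa [he.unique he']

theorem Arrow.matrix_mem_sp (a : Arrow l) : a.matrix ∈ sp l := by
  rw [mem_sp_iff, IsSymm]
  cases a with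
  | plain s t =>
    simp [Arrow.matrix, sub_mul, E_mul_form, sg_dual, sg_idx, add_comm]
  | dotted s t h =>
    rw [Arrow.matrix]
    split_ifs <;> simp [add_mul, E_mul_form, sg_dual, sg_idx, add_comm]
  | dottedLoopCcw i => simp [Arrow.matrix, E_mul_form, sg_dual, sg_idx]
  | dottedLoopCw i => simp [Arrow.matrix, E_mul_form, sg_idx]

/-- A nonzero product of entries `(r, c)` and `(c, d)` would come from one arrow, the one at the
vertex below `c`, contradicting `Arrow.Entry.not_comp`. -/
theorem Solp.matrix_mem_N2 (p : Solp l) : p.matrix ∈ N2 l := by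
  refine ⟨sum_mem fun a _ => a.matrix_mem_sp, ?_⟩
  ext r d
  rw [pow_two, mul_apply, Matrix.zero_apply]
  refine Finset.sum_eq_zero fun c _ => ?_
  by_contra h
  obtain ⟨a, ha, he⟩ := p.exists_entry (left_ne_zero_of_mul h)
  obtain ⟨a', ha', he'⟩ := p.exists_entry (right_ne_zero_of_mul h)
  obtain rfl := p.touched_once _ a ha a' ha' he.touches.2 he'.touches.1
  exact he.not_comp (p.ne_plain ha) he'

/-! ### Different patterns lie in different orbits -/

theorem borel_diag_ne_zero {b : GL (Fin (2 * l)) ℂ} (hb : b ∈ borel l) (i : Fin (2 * l)) :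
    b.val i i ≠ 0 := by
  have h : b.val.BlockTriangular id := fun i j h => hb.2 i j h
  have hdet : b.val.det ≠ 0 := (b.val.isUnit_iff_isUnit_det.1 b.isUnit).ne_zero
  rw [det_of_isUpperTriangular h, Finset.prod_ne_zero_iff] at hdet
  exact hdet i (Finset.mem_univ i)

/-- At `(r, c)` the left side is the single nonzero term `q.matrix r c * b c c`, while the right
side only involves entries of `p.matrix` in column `c` from row `r` down. -/
theorem Solp.exists_lower_entry {p q : Solp l} {b : GL (Fin (2 * l)) ℂ} (hb : b ∈ borel l)
    (h : q.matrix * b.val = b.val * p.matrix) {r c : Fin (2 * l)} (hq : q.matrix r c ≠ 0) :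
    ∃ k, r ≤ k ∧ p.matrix k c ≠ 0 := by
  have h1 : (q.matrix * b.val) r c ≠ 0 := by
    rw [mul_apply, Finset.sum_eq_single c]
    · exact mul_ne_zero hq (borel_diag_ne_zero hb c)
    · intro k _ hk
      rw [mul_eq_zero]
      left
      by_contra hk'
      exact hk (q.row hk' hq)
    · simp
  rw [h, mul_apply] at h1
  obtain ⟨k, -, hk⟩ := Finset.exists_ne_zero_of_sum_ne_zero h1
  refine ⟨k, not_lt.1 fun hlt => ?_, right_ne_zero_of_mul hk⟩
  exact left_ne_zero_of_mul hk (borel_apply_eq_zero hb hlt)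

theorem Solp.arrows_subset_of_conj {p q : Solp l} {b : GL (Fin (2 * l)) ℂ} (hb : b ∈ borel l)
    (h : q.matrix * b.val = b.val * p.matrix) : q.arrows ⊆ p.arrows := by
  refine Solp.arrows_subset fun r c hq => ?_
  have h' : p.matrix * (b⁻¹).val = (b⁻¹).val * q.matrix := by
    have h1 : b.val * (b⁻¹).val = 1 := b.mul_inv
    have h2 : (b⁻¹).val * b.val = 1 := b.inv_mul
    calc p.matrix * (b⁻¹).val = (b⁻¹).val * b.val * p.matrix * (b⁻¹).val := by rw [h2, one_mul]
      _ = (b⁻¹).val * (q.matrix * b.val) * (b⁻¹).val := by rw [h, mul_assoc (b⁻¹).val]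
      _ = (b⁻¹).val * q.matrix := by rw [mul_assoc, mul_assoc, h1, mul_one]
  obtain ⟨k, hrk, hk⟩ := exists_lower_entry hb h hq
  obtain ⟨m, hkm, hm⟩ := exists_lower_entry (inv_mem hb) h' hk
  -- Rows `r ≤ k ≤ m` were found in column `c`; the single entry of `q` in that column forces `m =
  -- r`, hence `k = r`.
  obtain rfl := q.col hm hq
  obtain rfl := le_antisymm hrk hkm
  exact hk

theorem Solp.eq_of_conj {p q : Solp l} {b : GL (Fin (2 * l)) ℂ} (hb : b ∈ borel l)
    (h : b.val * p.matrix * (b⁻¹).val = q.matrix) : p = q := by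
  have h1 : b.val * (b⁻¹).val = 1 := b.mul_inv
  have h2 : (b⁻¹).val * b.val = 1 := b.inv_mul
  have hq : q.matrix * b.val = b.val * p.matrix := by
    rw [← h, mul_assoc, h2, mul_one]
  have hp : p.matrix * (b⁻¹).val = (b⁻¹).val * q.matrix := by
    rw [← h, ← mul_assoc, ← mul_assoc, h2, one_mul]
  exact Solp.ext (subset_antisymm (arrows_subset_of_conj (inv_mem hb) hp)
    (arrows_subset_of_conj hb hq))

/-! ### Finiteness and conclusion -/

/-- Encoding of arrows used for finiteness. -/
def Arrow.code : Arrow l → Fin 4 × Fin l × Fin l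
  | .plain s t => (0, s, t)
  | .dotted s t _ => (1, s, t)
  | .dottedLoopCcw i => (2, i, i)
  | .dottedLoopCw i => (3, i, i)

instance : Finite (Arrow l) := by
  refine Finite.of_injective Arrow.code fun a a' h => ?_
  cases a <;> cases a' <;> simp_all [Arrow.code]

instance : Finite (Solp l) :=
  Finite.of_injective Solp.arrows fun _ _ h => Solp.ext h

end SympLink

theorem mainTheorem1 (l : ℕ) :
    (∃ h : ∀ p : SympLink.Solp l, p.matrix ∈ SympLink.N2 l,
      Function.Bijective
        (fun p : SympLink.Solp l =>
          (Quotient.mk _ ⟨p.matrix, h p⟩ : SympLink.Orbits l))) ∧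
    Finite (SympLink.Orbits l) := by
  open SympLink in
  have hbij : Function.Bijective (fun p : Solp l =>
      (Quotient.mk _ ⟨p.matrix, p.matrix_mem_N2⟩ : Orbits l)) := by
    constructor
    · intro p q hpq
      obtain ⟨b, hb⟩ := MulAction.orbitRel_apply.1 (Quotient.exact hpq)
      exact (Solp.eq_of_conj b.2 (congrArg Subtype.val hb)).symm
    · intro x
      induction x using Quotient.inductionOn with
      | h x =>
      obtain ⟨S, hS, hx⟩ := exists_eq_mul_form x.2
      obtain ⟨b, hb, -, p, -, hp⟩ := exists_solp Finset.univ (fun k _ => Finset.mem_univ _) S hS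
        (fun k hk => absurd (Finset.mem_univ k) hk)
      refine ⟨p, Quotient.sound (MulAction.orbitRel_apply.2 ⟨⟨b, hb⟩, Subtype.ext ?_⟩)⟩
      change b.val * x.1 * (b⁻¹).val = p.matrix
      rw [hx, conj_mul_form hb.1, hp]
  exact ⟨⟨_, hbij⟩, Finite.of_surjective _ hbij.2⟩
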